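/- **Setting.** All logarithms are to base $2$. A *binary memoryless synchronization error channel* is given by two probability distributions $p(\cdot\mid 0)$, $p(\cdot\mid 1)$ on the set $\{0,1\}^*$ of finite (possibly empty) binary strings. When $\mathbf X=(X_1,\dots,X_N)\in\{0,1\}^N$ is transmitted, each bit $X_i$ is independently replaced by a random string with distribution $p(\cdot\mid X_i)$, and the output $\mathbf Y\in\{0,1\}^*$ is the concatenation of these strings (without any marking of their boundaries). Let $M=|\mathbf Y|$ be the length of the output. For $\sigma>0$, the *AWGN/synchronization channel* outputs $\widetilde{\mathbf Y}=(\widetilde Y_1,\dots,\widetilde Y_M)$ instead of $\mathbf Y$, where $\widetilde Y_j=(1-2Y_j)+Z_j$ and $Z_1,Z_2,\dots$ are i.i.d. $\mathcal N(0,\sigma^2)$ random variables, independent of $(\mathbf X,\mathbf Y)$. The capacities of the two channels are the information capacities, in bits per channel use, $$C_s=\lim_{N\to\infty}\frac1N\sup_{P(\mathbf X)}I(\mathbf X;\mathbf Y),\qquad C_{As}=\lim_{N\to\infty}\frac1N\sup_{P(\mathbf X)}I(\mathbf X;\widetilde{\mathbf Y}),$$ where the suprema are over all probability distributions of $\mathbf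 X$ on $\{0,1\}^N$. **Theorem.** For every binary memoryless synchronization error channel and every $\sigma>0$, the two limits $C_s$ and $C_{As}$ exist and are finite. Moreover, let $(P_N)_{N\ge 1}$ be any capacity-achieving sequence of input distributions for the synchronization error channel, that is, $P_N$ is a probability distribution on $\{0,1\}^N$ and $\frac1N I(\mathbf X;\mathbf Y)\to C_s$ when $\mathbf X\sim P_N$, for which the limit $$r=\lim_{N\to\infty}\frac{E\{M\}}{N}\qquad(\mathbf X\sim P_N)$$ exists and is finite. Then $$C_{As}\ \ge\ C_s-r\,\log\!\left(\sqrt{\tfrac e2}\,\bigl(1+e^{-1/\sigma^2}\bigr)\right).$$ (If the mean length of the string that replaces a bit is the same finite number for both bits, then $r$ is this number, whatever the $P_N$ are.) -/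

import Mathlib

open MeasureTheory ProbabilityTheory Filter Topology
open scoped ENNReal NNReal

namespace SyncAWGN

noncomputable section

/-- Finite bit strings form a countable alphabet, carrying the discrete σ-algebra. -/
instance instMeasurableSpaceListBool : MeasurableSpace (List Bool) := ⊤

instance instDiscreteMeasurableSpaceListBool : DiscreteMeasurableSpace (List Bool) :=
  ⟨fun _ => trivial⟩

/-! ### Channels -/

/-- A binary memoryless channel with synchronization errors: the stochastic matrix `W b s` is the
probability that the transmitted bit `b` is replaced by the (possibly empty) finite string `s`. -/
abbrev SyncLaw : Type := Bool → PMF (List Bool)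

/-- The law of the received string when the given string is transmitted: every transmitted bit is
independently replaced by a random string, and the replacements are concatenated. -/
def syncOutput (W : SyncLaw) : List Bool → PMF (List Bool)
  | [] => PMF.pure []
  | b :: x => (W b).bind fun s => (syncOutput W x).map fun t => s ++ t

/-- `N` uses of the synchronization error channel, from input blocks of `N` bits to strings. -/
def syncChannel (W : SyncLaw) (N : ℕ) : Kernel (Fin N → Bool) (List Bool) :=
  Kernel.ofFunOfCountable fun x => (syncOutput W (List.ofFn x)).toMeasure

instance instIsMarkovKernelSyncChannel (W : SyncLaw) (N : ℕ) :
    IsMarkovKernel (syncChannel W N) :=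
  ⟨fun x => by
    change IsProbabilityMeasure ((syncOutput W (List.ofFn x)).toMeasure)
    infer_instance⟩

/-- BPSK modulation of a bit `x`, that is `1 - 2 x`. -/
def bpsk (b : Bool) : ℝ := if b then -1 else 1

/-- Finite strings of real numbers (of arbitrary length). -/
abbrev RealString : Type := Σ m : ℕ, (Fin m → ℝ)

/-- The memoryless binary input AWGN channel with noise variance `σ ^ 2`: the string `y` is received
as the real string of the same length with independent entries `bpsk y_i + Z_i`,
where `Z_i ∼ N(0, σ ^ 2)`, that is, the `i`-th entry has law `N(bpsk y_i, σ ^ 2)`. -/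
def awgnChannel (σ : ℝ) : Kernel (List Bool) RealString :=
  Kernel.ofFunOfCountable fun y =>
    (Measure.pi fun i : Fin y.length => gaussianReal (bpsk (y.get i)) (Real.toNNReal (σ ^ 2))).map
      (Sigma.mk y.length)

lemma measurable_sigmaMk (m : ℕ) :
    Measurable (Sigma.mk (β := fun m : ℕ => Fin m → ℝ) m) := by
  intro s hs
  exact MeasurableSpace.measurableSet_iInf.1 hs m

instance instIsMarkovKernelAwgnChannel (σ : ℝ) : IsMarkovKernel (awgnChannel σ) :=
  ⟨fun _ => Measure.isProbabilityMeasure_map (measurable_sigmaMk _).aemeasurable⟩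

/-- `N` uses of the AWGN/synchronization channel: the cascade of the synchronization error channel
and of the memoryless BI-AWGN channel, the two being independent. -/
def awgnSyncChannel (W : SyncLaw) (σ : ℝ) (N : ℕ) : Kernel (Fin N → Bool) RealString :=
  awgnChannel σ ∘ₖ syncChannel W N

instance instIsMarkovKernelAwgnSyncChannel (W : SyncLaw) (σ : ℝ) (N : ℕ) :
    IsMarkovKernel (awgnSyncChannel W σ N) := by
  unfold awgnSyncChannel
  infer_instance

/-! ### Mutual information and capacity -/

/-- The mutual information `I(X; Y)`, in bits, between an input `X` with law `P` and the output `Y`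
of the channel `κ`: the Kullback-Leibler divergence of the joint law from the product of the two
marginal laws (Mathlib's divergence is in nats). -/
def mutualInfo {α β : Type*} [MeasurableSpace α] [MeasurableSpace β]
    (P : Measure α) (κ : Kernel α β) : ℝ≥0∞ :=
  InformationTheory.klDiv (P ⊗ₘ κ) (P.prod (κ ∘ₘ P)) / ENNReal.ofReal (Real.log 2)

/-- The largest mutual information over all input laws. -/
def maxMutualInfo {α β : Type*} [MeasurableSpace α] [MeasurableSpace β]
    (κ : Kernel α β) : ℝ≥0∞ :=
  ⨆ P : ProbabilityMeasure α, mutualInfo (P : Measure α) κ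

/-- `C` is the (information) capacity, in bits per channel use, of the channel whose `N`-fold use is
`κ N`: `C = lim_{N → ∞} (1 / N) sup_{P(X)} I(X; Y)`, the limit being required to exist. -/
def IsCapacity {β : Type*} [MeasurableSpace β] (κ : ∀ N : ℕ, Kernel (Fin N → Bool) β)
    (C : ℝ≥0) : Prop :=
  Tendsto (fun N : ℕ => maxMutualInfo (κ N) / (N : ℝ≥0∞)) atTop (𝓝 (C : ℝ≥0∞))

/-- The input laws `P N` (on blocks of `N` bits) achieve the rate `C`:
`lim_{N → ∞} (1 / N) I(X; Y) = C`. -/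
def Achieves {β : Type*} [MeasurableSpace β] (κ : ∀ N : ℕ, Kernel (Fin N → Bool) β)
    (P : ∀ N : ℕ, ProbabilityMeasure (Fin N → Bool)) (C : ℝ≥0) : Prop :=
  Tendsto (fun N : ℕ => mutualInfo (P N : Measure (Fin N → Bool)) (κ N) / (N : ℝ≥0∞)) atTop
    (𝓝 (C : ℝ≥0∞))

/-- The expected length `E[M]` of the received string for an input block with law `P`. -/
def meanLength (W : SyncLaw) {N : ℕ} (P : ProbabilityMeasure (Fin N → Bool)) : ℝ≥0∞ :=
  ∫⁻ y, (y.length : ℝ≥0∞) ∂(syncChannel W N ∘ₘ (P : Measure (Fin N → Bool)))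

end

end SyncAWGN

-- The noise can destroy at most the information needed to recover `Y` from its noisy version `Ỹ`:
-- I(X;Y) - I(X;Ỹ) is at most the mean length of any code for `Y` given `Ỹ`. No true posterior is
-- needed, only weights on strings that sum to at most 1 for each `Ỹ`. This is
-- `klDiv_prod_comp_le_klDiv_add_lintegral`, proved with densities and log u ≤ u - 1, so that no
-- conditional entropy has to be defined.
--
-- Since `Ỹ` reveals the length `M`, the code can treat the `M` bits as independent and
-- equiprobable. A bit sent as x = ±1 and received as t then costs log(1 + exp(-2xt/σ²)) nats.
-- Jensen's inequality, applied after a Gaussian factor is split off, bounds the mean cost by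
-- log(√(e/2)(1 + exp(-1/σ²))) for either bit (`lintegral_bitCodeLength_le`). The loss per block is
-- therefore at most E[M] times this constant; dividing by `N` and letting `N` grow gives the bound.
--
-- Both capacities exist by Fekete's lemma: a block of m + n bits produces the concatenation of two
-- independent outputs, and concatenating can only lose information (`maxMutualInfo_le_add`). For
-- the noisy channel this uses that the noise acts letter by letter (`awgnChannel_append`).

namespace SyncAWGN

open InformationTheory

section Information

variable {α α₁ α₂ β β₁ β₂ γ : Type*} [MeasurableSpace α] [MeasurableSpace α₁] [MeasurableSpace α₂]
  [MeasurableSpace β] [MeasurableSpace β₁] [MeasurableSpace β₂] [MeasurableSpace γ]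

/-! ### Divergences of joint laws -/

/-- The divergence of two joint laws with the same countable first marginal is the average of the
conditional divergences. -/
lemma klDiv_compProd_right_eq_lintegral [Countable α] [DiscreteMeasurableSpace α]
    (P : Measure α) [IsFiniteMeasure P] (κ η : Kernel α β) [IsMarkovKernel κ] [IsMarkovKernel η] :
    klDiv (P ⊗ₘ κ) (P ⊗ₘ η) = ∫⁻ x, klDiv (κ x) (η x) ∂P := by
  by_cases h : P ⊗ₘ κ ≪ P ⊗ₘ η
  · have h' := Measure.absolutelyContinuous_compProd_right_iff.1 h
    have hm : Measurable (Function.uncurry (κ.rnDeriv η)) := by fun_prop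
    have hκ : P ⊗ₘ κ = (P ⊗ₘ η).withDensity fun p => κ.rnDeriv η p.1 p.2 := by
      rw [← Measure.compProd_withDensity hm]
      refine Measure.compProd_congr ?_
      filter_upwards [h'] with x hx using (Kernel.withDensity_rnDeriv_eq hx).symm
    have hd : (P ⊗ₘ κ).rnDeriv (P ⊗ₘ η) =ᵐ[P ⊗ₘ η] fun p => κ.rnDeriv η p.1 p.2 := by
      conv_lhs => rw [hκ]
      exact Measure.rnDeriv_withDensity _ (by fun_prop)
    rw [klDiv_eq_lintegral_klFun_of_ac h]
    calc ∫⁻ p, ENNReal.ofReal (klFun ((P ⊗ₘ κ).rnDeriv (P ⊗ₘ η) p).toReal) ∂(P ⊗ₘ η)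
      _ = ∫⁻ p, ENNReal.ofReal (klFun (κ.rnDeriv η p.1 p.2).toReal) ∂(P ⊗ₘ η) := by
          refine lintegral_congr_ae ?_
          filter_upwards [hd] with p hp
          rw [hp]
      _ = ∫⁻ x, ∫⁻ y, ENNReal.ofReal (klFun (κ.rnDeriv η x y).toReal) ∂(η x) ∂P :=
          Measure.lintegral_compProd (by fun_prop)
      _ = ∫⁻ x, klDiv (κ x) (η x) ∂P := by
          refine lintegral_congr_ae ?_
          filter_upwards [h'] with x hx
          rw [klDiv_eq_lintegral_klFun_of_ac hx]
          refine lintegral_congr_ae ?_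
          filter_upwards [κ.rnDeriv_eq_rnDeriv_measure (η := η) (a := x)] with y hy
          rw [hy]
  -- A finite average would make almost every conditional divergence finite, hence almost every `κ
  -- x` absolutely continuous, hence also the joint law.
  · rw [klDiv_of_not_ac h, eq_comm]
    by_contra hne
    refine h (Measure.absolutelyContinuous_compProd_right_iff.2 ?_)
    filter_upwards [ae_lt_top .of_discrete hne] with x hx
    by_contra hac
    simp [klDiv_of_not_ac hac] at hx

/-- Data processing for the swap and for its inverse. -/
lemma klDiv_map_swap (μ ν : Measure (α × β)) [IsFiniteMeasure μ] [IsFiniteMeasure ν] :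
    klDiv (μ.map Prod.swap) (ν.map Prod.swap) = klDiv μ ν := by
  refine le_antisymm (klDiv_map_le μ ν measurable_swap) ?_
  have := klDiv_map_le (μ.map Prod.swap) (ν.map Prod.swap) measurable_swap
  simpa [Measure.map_map measurable_swap measurable_swap] using this

lemma klDiv_prod_right (μ : Measure α) (ν ν' : Measure β) [IsProbabilityMeasure μ]
    [IsProbabilityMeasure ν] [IsProbabilityMeasure ν'] :
    klDiv (μ.prod ν) (μ.prod ν') = klDiv ν ν' := by
  rw [← klDiv_map_swap, Measure.prod_swap, Measure.prod_swap, ← Measure.compProd_const, ← Measure.compProd_const,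
    klDiv_compProd_left]

/-- The divergence of product laws is the sum of the divergences of the factors. -/
lemma klDiv_prod (μ μ' : Measure α) (ν ν' : Measure β) [IsProbabilityMeasure μ]
    [IsProbabilityMeasure μ'] [IsProbabilityMeasure ν] [IsProbabilityMeasure ν'] :
    klDiv (μ.prod ν) (μ'.prod ν') = klDiv μ μ' + klDiv ν ν' := by
  rw [← klDiv_prod_right μ ν ν', ← Measure.compProd_const (μ := μ),
    ← Measure.compProd_const (μ := μ'), klDiv_compProd_eq_add, Measure.compProd_const,
    Measure.compProd_const]

/-- Replacing the output law by any other law can only increase the divergence that defines the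
mutual information. -/
lemma klDiv_prod_comp_le [StandardBorelSpace α] (P : Measure α) [IsProbabilityMeasure P]
    (κ : Kernel α β) [IsMarkovKernel κ] (Q : Measure β) [IsProbabilityMeasure Q] :
    klDiv (P ⊗ₘ κ) (P.prod (κ ∘ₘ P)) ≤ klDiv (P ⊗ₘ κ) (P.prod Q) := by
  have : Nonempty α := nonempty_of_isProbabilityMeasure P
  -- Disintegrating along the output, with the posterior as kernel, puts `R` in the first marginal.
  -- The chain rule then splits off the divergence of the output law from `Q`, and what remains is
  -- the mutual information.
  have key : ∀ R : Measure β, IsProbabilityMeasure R →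
      klDiv (P ⊗ₘ κ) (P.prod R) = klDiv ((κ ∘ₘ P) ⊗ₘ κ†P) (R ⊗ₘ Kernel.const β P) := by
    intro R _
    rw [compProd_posterior_eq_map_swap, Measure.compProd_const,
      ← Measure.prod_swap (μ := P) (ν := R), klDiv_map_swap]
  rw [key _ inferInstance, key _ inferInstance,
    klDiv_compProd_eq_add (κ ∘ₘ P) Q (κ†P) (Kernel.const β P)]
  exact le_add_self

lemma klDiv_prod_comp_le_lintegral [Countable α] [DiscreteMeasurableSpace α] (P : Measure α)
    [IsProbabilityMeasure P] (κ : Kernel α β) [IsMarkovKernel κ] (Q : Measure β)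
    [IsProbabilityMeasure Q] :
    klDiv (P ⊗ₘ κ) (P.prod (κ ∘ₘ P)) ≤ ∫⁻ x, klDiv (κ x) Q ∂P := by
  refine (klDiv_prod_comp_le P κ Q).trans_eq ?_
  rw [← Measure.compProd_const, klDiv_compProd_right_eq_lintegral]
  simp

lemma klDiv_prod_comp_eq_lintegral [Countable α] [DiscreteMeasurableSpace α] (P : Measure α)
    [IsProbabilityMeasure P] (κ : Kernel α β) [IsMarkovKernel κ] :
    klDiv (P ⊗ₘ κ) (P.prod (κ ∘ₘ P)) = ∫⁻ x, klDiv (κ x) (κ ∘ₘ P) ∂P := by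
  rw [← Measure.compProd_const, klDiv_compProd_right_eq_lintegral]
  simp

/-! ### Mutual information of channels with a finite input alphabet -/

lemma klDiv_dirac_uniformOn_ne_top [Fintype α] [DiscreteMeasurableSpace α] (x : α) :
    klDiv (Measure.dirac x) (uniformOn Set.univ) ≠ ∞ := by
  have : Nonempty α := ⟨x⟩
  refine klDiv_ne_top (Measure.AbsolutelyContinuous.mk fun s hs h => ?_) (integrable_dirac (by simp))
  rw [uniformOn_eq_zero_iff Set.finite_univ, Set.univ_inter] at h
  simp [h]

/-- The mutual information is bounded, uniformly in the input law. -/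
lemma maxMutualInfo_ne_top [Fintype α] [DiscreteMeasurableSpace α]
    (κ : Kernel α β) [IsMarkovKernel κ] : maxMutualInfo κ ≠ ∞ := by
  have hlog : ENNReal.ofReal (Real.log 2) ≠ 0 := by
    simpa using Real.log_pos one_lt_two
  have hfin : ∑ x : α, klDiv (Measure.dirac x) (uniformOn Set.univ) ≠ ∞ :=
    (ENNReal.sum_lt_top.2 fun x _ => (klDiv_dirac_uniformOn_ne_top x).lt_top).ne
  refine ne_top_of_le_ne_top (ENNReal.div_ne_top hfin hlog) (iSup_le fun P => ?_)
  have : Nonempty α := nonempty_of_isProbabilityMeasure (P : Measure α)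
  refine ENNReal.div_le_div_right ?_ _
  -- With the response to a uniform input as reference law, data processing bounds each term by the
  -- divergence of a point mass from the uniform law, a bound free of `P`.
  refine (klDiv_prod_comp_le_lintegral (P : Measure α) κ (κ ∘ₘ uniformOn Set.univ)).trans ?_
  calc ∫⁻ x, klDiv (κ x) (κ ∘ₘ uniformOn Set.univ) ∂(P : Measure α)
    _ ≤ ∫⁻ _, ∑ x : α, klDiv (Measure.dirac x) (uniformOn Set.univ) ∂(P : Measure α) := by
        refine lintegral_mono fun x => ?_
        refine le_trans ?_ (Finset.single_le_sum
          (f := fun x => klDiv (Measure.dirac x) (uniformOn Set.univ))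
          (fun _ _ => zero_le) (Finset.mem_univ x))
        have := klDiv_comp_right_le (Measure.dirac x) (uniformOn Set.univ) κ
        rwa [Measure.dirac_bind κ.measurable] at this
    _ = _ := by simp

/-- Mutual information is subadditive for channels whose output is a function of the outputs of two
independent channels that act on two parts of the input. -/
lemma mutualInfo_le_add [Countable α] [DiscreteMeasurableSpace α]
    [Countable α₁] [DiscreteMeasurableSpace α₁] [Countable α₂] [DiscreteMeasurableSpace α₂]
    (P : Measure α) [IsProbabilityMeasure P] (κ : Kernel α β) [IsMarkovKernel κ]
    (κ₁ : Kernel α₁ β₁) [IsMarkovKernel κ₁] (κ₂ : Kernel α₂ β₂) [IsMarkovKernel κ₂]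
    (e₁ : α → α₁) (e₂ : α → α₂) {f : β₁ × β₂ → β} (hf : Measurable f)
    (hκ : ∀ x, κ x = ((κ₁ (e₁ x)).prod (κ₂ (e₂ x))).map f) :
    mutualInfo P κ ≤ mutualInfo (P.map e₁) κ₁ + mutualInfo (P.map e₂) κ₂ := by
  have he₁ : Measurable e₁ := .of_discrete
  have he₂ : Measurable e₂ := .of_discrete
  have := Measure.isProbabilityMeasure_map (μ := P) he₁.aemeasurable
  have := Measure.isProbabilityMeasure_map (μ := P) he₂.aemeasurable
  simp only [mutualInfo]
  rw [← ENNReal.add_div]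
  refine ENNReal.div_le_div_right ?_ _
  set Q₁ := κ₁ ∘ₘ P.map e₁ with hQ₁
  set Q₂ := κ₂ ∘ₘ P.map e₂ with hQ₂
  have := Measure.isProbabilityMeasure_map (μ := Q₁.prod Q₂) hf.aemeasurable
  calc klDiv (P ⊗ₘ κ) (P.prod (κ ∘ₘ P))
    -- The two output parts may be dependent under `P`; the reference law treats them as
    -- independent, which only increases the divergence.
    _ ≤ ∫⁻ x, klDiv (κ x) ((Q₁.prod Q₂).map f) ∂P := klDiv_prod_comp_le_lintegral _ _ _
    _ ≤ ∫⁻ x, (klDiv (κ₁ (e₁ x)) Q₁ + klDiv (κ₂ (e₂ x)) Q₂) ∂P := by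
        refine lintegral_mono fun x => ?_
        rw [hκ, ← klDiv_prod]
        exact klDiv_map_le _ _ hf
    _ = klDiv (P.map e₁ ⊗ₘ κ₁) ((P.map e₁).prod Q₁)
          + klDiv (P.map e₂ ⊗ₘ κ₂) ((P.map e₂).prod Q₂) := by
        rw [klDiv_prod_comp_eq_lintegral, klDiv_prod_comp_eq_lintegral,
          lintegral_map .of_discrete he₁, lintegral_map .of_discrete he₂,
          lintegral_add_left .of_discrete]

lemma maxMutualInfo_le_add [Countable α] [DiscreteMeasurableSpace α]
    [Countable α₁] [DiscreteMeasurableSpace α₁] [Countable α₂] [DiscreteMeasurableSpace α₂]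
    (κ : Kernel α β) [IsMarkovKernel κ]
    (κ₁ : Kernel α₁ β₁) [IsMarkovKernel κ₁] (κ₂ : Kernel α₂ β₂) [IsMarkovKernel κ₂]
    (e₁ : α → α₁) (e₂ : α → α₂) {f : β₁ × β₂ → β} (hf : Measurable f)
    (hκ : ∀ x, κ x = ((κ₁ (e₁ x)).prod (κ₂ (e₂ x))).map f) :
    maxMutualInfo κ ≤ maxMutualInfo κ₁ + maxMutualInfo κ₂ := by
  refine iSup_le fun P => (mutualInfo_le_add _ κ κ₁ κ₂ e₁ e₂ hf hκ).trans ?_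
  have he₁ : Measurable e₁ := .of_discrete
  have he₂ : Measurable e₂ := .of_discrete
  exact add_le_add
    (le_iSup (fun P : ProbabilityMeasure α₁ => mutualInfo (P : Measure α₁) κ₁)
      (P.map he₁.aemeasurable))
    (le_iSup (fun P : ProbabilityMeasure α₂ => mutualInfo (P : Measure α₂) κ₂)
      (P.map he₂.aemeasurable))

/-! ### Loss of mutual information in a cascade of channels -/

lemma map_compProd_compProd_comap_snd (P : Measure α) [IsProbabilityMeasure P]
    (W : Kernel α β) [IsMarkovKernel W] (V : Kernel β γ) [IsMarkovKernel V] :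
    ((P ⊗ₘ W) ⊗ₘ V.comap Prod.snd measurable_snd).map (fun p => (p.1.1, p.2)) =
      P ⊗ₘ (V ∘ₖ W) := by
  have hg : Measurable fun p : (α × β) × γ => (p.1.1, p.2) := by fun_prop
  ext s hs
  rw [Measure.map_apply hg hs, Measure.compProd_apply (hg hs), Measure.compProd_apply hs,
    Measure.lintegral_compProd (Kernel.measurable_kernel_prodMk_left (hg hs))]
  refine lintegral_congr fun x => ?_
  rw [Kernel.comp_apply' _ _ _ (measurable_prodMk_left hs)]
  rfl

/-- The density integrates over the strip of points with output `y` to at most the joint mass of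
that strip, which is `(W ∘ₘ P) {y}`; dividing by this positive mass gives the bound. -/
lemma lintegral_rnDeriv_prod_section_le_one [MeasurableSingletonClass β] (P : Measure α)
    [IsProbabilityMeasure P] (W : Kernel α β) [IsMarkovKernel W] {y : β} (hy : (W ∘ₘ P) {y} ≠ 0) :
    ∫⁻ x, (P ⊗ₘ W).rnDeriv (P.prod (W ∘ₘ P)) (x, y) ∂P ≤ 1 := by
  set q := W ∘ₘ P with hq
  set ψ := (P ⊗ₘ W).rnDeriv (P.prod q) with hψ
  have hψm : Measurable ψ := Measure.measurable_rnDeriv _ _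
  have h1 : ∫⁻ p in Set.univ ×ˢ {y}, ψ p ∂(P.prod q) ≤ q {y} := by
    refine (Measure.setLIntegral_rnDeriv_le _).trans_eq ?_
    rw [hq, ← Measure.snd_compProd, Measure.snd_apply (measurableSet_singleton y),
      Set.univ_prod]
  rw [← Measure.prod_restrict, Measure.restrict_univ, lintegral_prod _ hψm.aemeasurable] at h1
  simp only [lintegral_singleton] at h1
  rw [lintegral_mul_const _ (by fun_prop)] at h1
  exact (ENNReal.mul_le_mul_iff_left hy (measure_ne_top q {y})).1 (by rwa [one_mul])

/-- If `y` can be described, given the output `ω` of the second channel, by a code of length `ℓ y ω`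
nats, then the second channel loses at most the mean code length. -/
lemma klDiv_prod_comp_le_klDiv_add_lintegral [Countable β] [DiscreteMeasurableSpace β]
    (P : Measure α) [IsProbabilityMeasure P] (W : Kernel α β) [IsMarkovKernel W] (V : Kernel β γ)
    [IsMarkovKernel V] (ϖ : β → γ → ℝ≥0∞) (hϖ : ∀ y, Measurable (ϖ y))
    (hsum : ∀ ω, ∑' y, ϖ y ω ≤ 1) (ℓ : β → γ → ℝ) (hℓm : ∀ y, Measurable (ℓ y))
    (hℓ0 : ∀ y ω, 0 ≤ ℓ y ω)
    (hℓ : ∀ y, ∀ᵐ ω ∂(V y), ENNReal.ofReal (Real.exp (-ℓ y ω)) ≤ ϖ y ω)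
    (hfin : klDiv (P ⊗ₘ W) (P.prod (W ∘ₘ P)) ≠ ∞) :
    klDiv (P ⊗ₘ W) (P.prod (W ∘ₘ P)) ≤
      klDiv (P ⊗ₘ (V ∘ₖ W)) (P.prod ((V ∘ₖ W) ∘ₘ P)) +
        ∫⁻ y, ∫⁻ ω, ENNReal.ofReal (ℓ y ω) ∂(V y) ∂(W ∘ₘ P) := by
  set q := W ∘ₘ P with hq
  set F := (V ∘ₖ W) ∘ₘ P with hF
  set K := klDiv (P ⊗ₘ (V ∘ₖ W)) (P.prod F) with hK
  set L := ∫⁻ y, ∫⁻ ω, ENNReal.ofReal (ℓ y ω) ∂(V y) ∂q with hL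
  by_cases hKtop : K = ∞
  · simp [hKtop]
  by_cases hLtop : L = ∞
  · simp [hLtop]
  obtain ⟨hac, hint⟩ := klDiv_ne_top_iff.1 hfin
  obtain ⟨hac', hint'⟩ := klDiv_ne_top_iff.1 hKtop
  set ψ := (P ⊗ₘ W).rnDeriv (P.prod q) with hψ
  set φ := (P ⊗ₘ (V ∘ₖ W)).rnDeriv (P.prod F) with hφ
  have hψm : Measurable ψ := Measure.measurable_rnDeriv _ _
  have hφm : Measurable φ := Measure.measurable_rnDeriv _ _
  -- The joint law of input, intermediate output and final output, on which all densities are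
  -- compared.
  let J := (P ⊗ₘ W) ⊗ₘ V.comap Prod.snd measurable_snd
  have hJ₁ : J.map Prod.fst = P ⊗ₘ W := Measure.fst_compProd _ _
  have hJ₂ : J.map (fun p => (p.1.1, p.2)) = P ⊗ₘ (V ∘ₖ W) :=
    map_compProd_compProd_comap_snd P W V
  have hg : Measurable fun p : (α × β) × γ => (p.1.1, p.2) := by fun_prop
  have hJq : J.map (fun p => p.1.2) = q := by
    have : (fun p : (α × β) × γ => p.1.2) = Prod.snd ∘ Prod.fst := rfl
    rw [this, ← Measure.map_map measurable_snd measurable_fst, hJ₁]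
    exact Measure.snd_compProd _ _
  -- the density bound of the output law
  let G : α × γ → ℝ≥0∞ := fun p => ∑' y, if q {y} = 0 then 0 else ψ (p.1, y) * ϖ y p.2
  have hterm : ∀ y, Measurable fun p : α × γ =>
      if q {y} = 0 then 0 else ψ (p.1, y) * ϖ y p.2 := by
    intro y
    have := hϖ y
    split_ifs <;> fun_prop
  have hGm : Measurable G := Measurable.tsum hterm
  -- Under the product law each term factors; sections of `ψ` have mass at most 1 and the weights
  -- sum to at most 1. Points with `q {y} = 0` are left out of `G` because `ψ` is not controlled
  -- there.
  have hG1 : ∫⁻ p, G p ∂(P.prod F) ≤ 1 := by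
    rw [lintegral_tsum fun y => (hterm y).aemeasurable]
    calc ∑' y, ∫⁻ p, (if q {y} = 0 then 0 else ψ (p.1, y) * ϖ y p.2) ∂(P.prod F)
      _ ≤ ∑' y, ∫⁻ ω, ϖ y ω ∂F := by
          refine ENNReal.tsum_le_tsum fun y => ?_
          split_ifs with h0
          · simp
          · have hψy : AEMeasurable (fun x => ψ (x, y)) P := by fun_prop
            rw [lintegral_prod_mul hψy (hϖ y).aemeasurable]
            exact (mul_le_mul_left (lintegral_rnDeriv_prod_section_le_one P W h0) _).trans_eq
              (one_mul _)
      _ = ∫⁻ ω, ∑' y, ϖ y ω ∂F := (lintegral_tsum fun y => (hϖ y).aemeasurable).symm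
      _ ≤ ∫⁻ _, 1 ∂F := lintegral_mono hsum
      _ = 1 := by simp
  have hGφm : Measurable fun p => G p / φ p := hGm.div hφm
  have hGφ : ∫⁻ p, G p / φ p ∂(P ⊗ₘ (V ∘ₖ W)) ≤ 1 := by
    rw [← lintegral_rnDeriv_mul hac' hGφm.aemeasurable]
    exact (lintegral_mono fun p => ENNReal.mul_div_le).trans hG1
  have hGφJ : ∫⁻ p, G (p.1.1, p.2) / φ (p.1.1, p.2) ∂J ≤ 1 := by
    rw [← lintegral_map hGφm hg, hJ₂]
    exact hGφ
  -- almost sure properties under the joint law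
  have hψJ : ∀ᵐ p ∂J, 0 < ψ p.1 ∧ ψ p.1 < ∞ := by
    refine ae_of_ae_map measurable_fst.aemeasurable (p := fun z => 0 < ψ z ∧ ψ z < ∞) ?_
    rw [hJ₁]
    filter_upwards [Measure.rnDeriv_pos hac, hac.ae_le (Measure.rnDeriv_lt_top (P ⊗ₘ W) (P.prod q))] with z h1 h2
      using ⟨h1, h2⟩
  have hφJ : ∀ᵐ p ∂J, (0 < φ (p.1.1, p.2) ∧ φ (p.1.1, p.2) < ∞) ∧ G (p.1.1, p.2) < ∞ := by
    refine ae_of_ae_map hg.aemeasurable (p := fun z => (0 < φ z ∧ φ z < ∞) ∧ G z < ∞) ?_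
    rw [hJ₂]
    filter_upwards [Measure.rnDeriv_pos hac', hac'.ae_le (Measure.rnDeriv_lt_top (P ⊗ₘ (V ∘ₖ W)) (P.prod F)),
      hac'.ae_le (ae_lt_top hGm (ne_top_of_le_ne_top ENNReal.one_ne_top hG1))] with z h1 h2 h3
      using ⟨⟨h1, h2⟩, h3⟩
  have hqJ : ∀ᵐ p ∂J, q {p.1.2} ≠ 0 := by
    refine ae_of_ae_map (f := fun p : (α × β) × γ => p.1.2) (by fun_prop)
      (p := fun y => q {y} ≠ 0) ?_
    rw [hJq, ae_iff_of_countable]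
    exact fun y hy => hy
  have hℓm' : Measurable fun p : (α × β) × γ => ℓ p.1.2 p.2 := by
    have : Measurable (Function.uncurry ℓ) := measurable_from_prod_countable_right hℓm
    exact this.comp (g := Function.uncurry ℓ) (f := fun p : (α × β) × γ => (p.1.2, p.2))
      (by fun_prop)
  have hϖm' : Measurable fun p : (α × β) × γ => ϖ p.1.2 p.2 := by
    have : Measurable (Function.uncurry ϖ) := measurable_from_prod_countable_right hϖ
    exact this.comp (g := Function.uncurry ϖ) (f := fun p : (α × β) × γ => (p.1.2, p.2))
      (by fun_prop)
  have hℓJ : ∀ᵐ p ∂J, ENNReal.ofReal (Real.exp (-ℓ p.1.2 p.2)) ≤ ϖ p.1.2 p.2 := by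
    refine (Measure.ae_compProd_iff (measurableSet_le hℓm'.neg.exp.ennreal_ofReal hϖm')).2 ?_
    exact ae_of_all _ fun z => hℓ z.2
  -- integrals under the joint law
  have hLJ : ∫⁻ p, ENNReal.ofReal (ℓ p.1.2 p.2) ∂J = L := by
    rw [Measure.lintegral_compProd hℓm'.ennreal_ofReal, hL, hq, ← Measure.snd_compProd P W, Measure.snd,
      lintegral_map .of_discrete measurable_snd]
    rfl
  have hℓint : Integrable (fun p => ℓ p.1.2 p.2) J := by
    refine ⟨hℓm'.aestronglyMeasurable, ?_⟩
    rw [hasFiniteIntegral_iff_ofReal (ae_of_all _ fun p => hℓ0 _ _), hLJ]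
    exact lt_top_iff_ne_top.2 hLtop
  have hψint : Integrable (fun p => Real.log (ψ p.1).toReal) J :=
    Integrable.comp_measurable (f := fun p : (α × β) × γ => p.1)
      (g := fun z => Real.log (ψ z).toReal) (by rw [hJ₁]; exact hint) measurable_fst
  have hφint : Integrable (fun p => Real.log (φ (p.1.1, p.2)).toReal) J :=
    Integrable.comp_measurable (f := fun p : (α × β) × γ => (p.1.1, p.2))
      (g := fun z => Real.log (φ z).toReal) (by rw [hJ₂]; exact hint') hg
  have hGint : Integrable (fun p => (G (p.1.1, p.2) / φ (p.1.1, p.2)).toReal) J :=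
    integrable_toReal_of_lintegral_ne_top (hGφm.comp hg).aemeasurable
      (ne_top_of_le_ne_top ENNReal.one_ne_top hGφJ)
  -- Keeping one term of `G` gives log ψ ≤ ℓ + log G, and log(G/φ) ≤ G/φ - 1, whose mean is at most
  -- 0 by `hGφJ`.
  have hpt : ∀ᵐ p ∂J, Real.log (ψ p.1).toReal ≤ ℓ p.1.2 p.2 + Real.log (φ (p.1.1, p.2)).toReal
      + ((G (p.1.1, p.2) / φ (p.1.1, p.2)).toReal - 1) := by
    filter_upwards [hψJ, hφJ, hqJ, hℓJ] with p h1 h2 h3 h4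
    have hψp : 0 < (ψ p.1).toReal := ENNReal.toReal_pos h1.1.ne' h1.2.ne
    have hφp : 0 < (φ (p.1.1, p.2)).toReal := ENNReal.toReal_pos h2.1.1.ne' h2.1.2.ne
    have hle : (ψ p.1).toReal * Real.exp (-ℓ p.1.2 p.2) ≤ (G (p.1.1, p.2)).toReal := by
      rw [← ENNReal.toReal_ofReal (Real.exp_pos (-ℓ p.1.2 p.2)).le, ← ENNReal.toReal_mul]
      refine ENNReal.toReal_mono h2.2.ne ?_
      refine le_trans ?_ (ENNReal.le_tsum p.1.2)
      rw [if_neg h3]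
      exact mul_le_mul_right h4 _
    have hGp : 0 < (G (p.1.1, p.2)).toReal := lt_of_lt_of_le (by positivity) hle
    have hlog := Real.log_le_log (by positivity) hle
    rw [Real.log_mul hψp.ne' (Real.exp_pos _).ne', Real.log_exp] at hlog
    have h5 := Real.log_le_sub_one_of_pos (div_pos hGp hφp)
    rw [Real.log_div hGp.ne' hφp.ne'] at h5
    rw [ENNReal.toReal_div]
    linarith
  have hmono := integral_mono_ae hψint
    ((hℓint.add hφint).add (hGint.sub (integrable_const 1))) hpt
  have e1 : ∫ p, Real.log (ψ p.1).toReal ∂J = (klDiv (P ⊗ₘ W) (P.prod q)).toReal := by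
    rw [toReal_klDiv_of_measure_eq hac (by simp), ← hJ₁,
      integral_map measurable_fst.aemeasurable
        (by rw [hJ₁]; exact (measurable_llr _ _).aestronglyMeasurable), hJ₁]
    rfl
  have e2 : ∫ p, Real.log (φ (p.1.1, p.2)).toReal ∂J = K.toReal := by
    rw [hK, toReal_klDiv_of_measure_eq hac' (by simp), ← hJ₂,
      integral_map hg.aemeasurable
        (by rw [hJ₂]; exact (measurable_llr _ _).aestronglyMeasurable), hJ₂]
    rfl
  have e3 : ∫ p, ℓ p.1.2 p.2 ∂J = L.toReal := by
    rw [integral_eq_lintegral_of_nonneg_ae (ae_of_all _ fun p => hℓ0 _ _)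
      hℓm'.aestronglyMeasurable, hLJ]
  have e4 : ∫ p, (G (p.1.1, p.2) / φ (p.1.1, p.2)).toReal ∂J ≤ 1 := by
    refine (integral_toReal (hGφm.comp hg).aemeasurable
      (ae_lt_top (hGφm.comp hg) (ne_top_of_le_ne_top ENNReal.one_ne_top hGφJ))).trans_le ?_
    exact ENNReal.toReal_mono ENNReal.one_ne_top hGφJ
  rw [integral_add' (hℓint.add hφint) (hGint.sub (integrable_const 1)),
    integral_add' hℓint hφint, integral_sub' hGint (integrable_const 1), e1, e2, e3] at hmono
  simp only [integral_const, probReal_univ, smul_eq_mul] at hmono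
  rw [← ENNReal.toReal_le_toReal hfin (ENNReal.add_ne_top.2 ⟨hKtop, hLtop⟩),
    ENNReal.toReal_add hKtop hLtop]
  linarith

end Information

/-! ### Real strings -/

namespace RealString

/-- The `i`-th entry of a real string, and `0` beyond its end. -/
noncomputable def coord (i : ℕ) (ω : RealString) : ℝ := if h : i < ω.1 then ω.2 ⟨i, h⟩ else 0

lemma coord_mk (m : ℕ) (t : Fin m → ℝ) (i : ℕ) :
    coord i ⟨m, t⟩ = if h : i < m then t ⟨i, h⟩ else 0 := rfl

lemma coord_of_lt {i : ℕ} {ω : RealString} (h : i < ω.1) : coord i ω = ω.2 ⟨i, h⟩ := dif_pos h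

lemma ext_coord {ω ω' : RealString} (h : ω.1 = ω'.1) (hc : ∀ i, coord i ω = coord i ω') :
    ω = ω' := by
  obtain ⟨m, t⟩ := ω
  obtain ⟨n, u⟩ := ω'
  obtain rfl : m = n := h
  congr 1
  ext i
  simpa [coord_mk] using hc i

lemma measurable_of_mk {X : Type*} [MeasurableSpace X] {f : RealString → X}
    (h : ∀ m, Measurable fun t : Fin m → ℝ => f ⟨m, t⟩) : Measurable f :=
  fun _ hs => MeasurableSpace.measurableSet_iInf.2 fun m => h m hs

lemma measurable_length : Measurable fun ω : RealString => ω.1 :=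
  measurable_of_mk fun _ => measurable_const

lemma measurable_coord (i : ℕ) : Measurable (coord i) := by
  refine measurable_of_mk fun m => ?_
  simp only [coord_mk]
  split_ifs <;> fun_prop

/-- On each of the countably many events that fix the length, the string is a measurable function of
finitely many coordinates. This reduces measurability of `cons` and `append` to real-valued maps. -/
lemma measurable_of_coord {X : Type*} [MeasurableSpace X] {f : X → RealString}
    (h : Measurable fun x => (f x).1) (hc : ∀ i, Measurable fun x => coord i (f x)) :
    Measurable f := by
  intro s hs
  have hs' : f ⁻¹' s = ⋃ m, (fun x => (f x).1) ⁻¹' {m} ∩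
      (fun x (i : Fin m) => coord i (f x)) ⁻¹' ((fun t : Fin m → ℝ => (⟨m, t⟩ : RealString)) ⁻¹' s) := by
    have hmk : ∀ x, (⟨(f x).1, fun i : Fin (f x).1 => coord i (f x)⟩ : RealString) = f x := by
      intro x
      simp [coord]
    ext x
    simp only [Set.mem_preimage, Set.mem_iUnion, Set.mem_inter_iff, Set.mem_singleton_iff]
    constructor
    · intro hx
      exact ⟨_, rfl, by rwa [hmk]⟩
    · rintro ⟨m, rfl, hx⟩
      rwa [hmk] at hx
  rw [hs']
  refine MeasurableSet.iUnion fun m => (h (measurableSet_singleton m)).inter ?_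
  have hm : Measurable fun x (i : Fin m) => coord i (f x) := measurable_pi_lambda _ fun i => hc i
  exact hm (measurable_sigmaMk m hs)

/-- Prepending a real number to a real string. -/
def cons (p : ℝ × RealString) : RealString := ⟨p.2.1 + 1, Fin.cons p.1 p.2.2⟩

/-- Concatenation of two real strings. -/
def append (p : RealString × RealString) : RealString := ⟨p.1.1 + p.2.1, Fin.append p.1.2 p.2.2⟩

lemma coord_zero_cons (p : ℝ × RealString) : coord 0 (cons p) = p.1 := by
  simp [coord, cons]

lemma coord_succ_cons (p : ℝ × RealString) (i : ℕ) : coord (i + 1) (cons p) = coord i p.2 := by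
  by_cases h : i < p.2.1
  · rw [coord_of_lt h, coord_of_lt (show i + 1 < (cons p).1 from Nat.succ_lt_succ h)]
    rfl
  · simp [coord, cons, h]

lemma coord_append (p : RealString × RealString) (i : ℕ) :
    coord i (append p) = if i < p.1.1 then coord i p.1 else coord (i - p.1.1) p.2 := by
  by_cases h : i < p.1.1
  · rw [if_pos h]
    rw [coord_of_lt h, coord_of_lt (show i < (append p).1 from Nat.lt_add_right _ h)]
    exact Fin.append_left p.1.2 p.2.2 ⟨i, h⟩
  · by_cases h' : i < p.1.1 + p.2.1
    · have h'' : i - p.1.1 < p.2.1 := by omega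
      have : (⟨i, h'⟩ : Fin (p.1.1 + p.2.1)) = Fin.natAdd p.1.1 ⟨i - p.1.1, h''⟩ := by
        ext
        simp
        omega
      simp only [coord, append, h, h', h'', dite_true, if_false, this, Fin.append_right]
    · have h'' : ¬ i - p.1.1 < p.2.1 := by omega
      simp [coord, append, h, h', h'']

lemma measurable_cons : Measurable cons := by
  refine measurable_of_coord ?_ fun i => ?_
  · exact (measurable_length.comp measurable_snd).add_const 1
  · cases i with
    | zero => simpa only [coord_zero_cons] using measurable_fst
    | succ i =>
      simp only [coord_succ_cons]
      exact (measurable_coord i).comp measurable_snd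

lemma measurable_append : Measurable append := by
  have h1 : Measurable fun p : RealString × RealString => p.1.1 :=
    measurable_length.comp measurable_fst
  refine measurable_of_coord (h1.add (measurable_length.comp measurable_snd)) fun i => ?_
  simp only [coord_append]
  refine Measurable.ite (h1 (Set.to_countable {n | i < n}).measurableSet)
    ((measurable_coord i).comp measurable_fst) ?_
  have h2 : Measurable (Function.uncurry coord) := measurable_from_prod_countable_right measurable_coord
  exact h2.comp (Measurable.prodMk ((measurable_of_countable fun n => i - n).comp h1) measurable_snd)

lemma append_cons (s : ℝ) (u w : RealString) :
    append (cons (s, u), w) = cons (s, append (u, w)) := by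
  refine ext_coord (by simp [append, cons]; omega) fun i => ?_
  rw [coord_append]
  cases i with
  | zero =>
    rw [coord_zero_cons, if_pos (by simp [cons]), coord_zero_cons]
  | succ i =>
    simp only [coord_succ_cons, coord_append]
    simp [cons]

lemma append_nil (t : Fin 0 → ℝ) (w : RealString) : append (⟨0, t⟩, w) = w := by
  refine ext_coord (by simp [append]) fun i => ?_
  simp [coord_append]

end RealString

/-! ### The AWGN channel on concatenated strings -/

lemma awgnChannel_apply (σ : ℝ) (y : List Bool) :
    awgnChannel σ y = (Measure.pi fun i : Fin y.length =>
      gaussianReal (bpsk (y.get i)) (Real.toNNReal (σ ^ 2))).map (Sigma.mk y.length) := rfl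

lemma awgnChannel_nil (σ : ℝ) : awgnChannel σ [] = Measure.dirac ⟨0, Fin.elim0⟩ := by
  rw [awgnChannel_apply]
  change (Measure.pi fun i : Fin 0 => _).map _ = _
  rw [Measure.pi_of_empty _ (Fin.elim0 : Fin 0 → ℝ), Measure.map_dirac' (measurable_sigmaMk _)]
  rfl

lemma awgnChannel_cons (σ : ℝ) (b : Bool) (y : List Bool) :
    awgnChannel σ (b :: y) =
      ((gaussianReal (bpsk b) (Real.toNNReal (σ ^ 2))).prod (awgnChannel σ y)).map
        RealString.cons := by
  have h := (measurePreserving_piFinSuccAbove (fun i : Fin (y.length + 1) =>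
    gaussianReal (bpsk ((b :: y).get i)) (Real.toNNReal (σ ^ 2))) 0).symm.map_eq
  rw [awgnChannel_apply, awgnChannel_apply]
  change (Measure.pi fun i : Fin (y.length + 1) =>
    gaussianReal (bpsk ((b :: y).get i)) (Real.toNNReal (σ ^ 2))).map
      (Sigma.mk (β := fun m : ℕ => Fin m → ℝ) (y.length + 1)) = _
  rw [← h, Measure.map_map (measurable_sigmaMk _) (MeasurableEquiv.measurable _)]
  conv_rhs =>
    rw [← Measure.map_id (μ := gaussianReal (bpsk b) (Real.toNNReal (σ ^ 2))),
      Measure.map_prod_map _ _ measurable_id (measurable_sigmaMk _),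
      Measure.map_map RealString.measurable_cons (measurable_id.prodMap (measurable_sigmaMk _))]
  congr 1
  funext p
  simp only [Function.comp_apply, RealString.cons, Prod.map, id]
  congr 1
  exact Fin.insertNth_zero' p.1 p.2

/-- The noise is independent from letter to letter, so it commutes with concatenation; the induction
peels off one letter and reassociates the product law. -/
lemma awgnChannel_append (σ : ℝ) (y y' : List Bool) :
    awgnChannel σ (y ++ y') =
      ((awgnChannel σ y).prod (awgnChannel σ y')).map RealString.append := by
  induction y with
  | nil =>
    rw [List.nil_append, awgnChannel_nil, Measure.dirac_prod,
      Measure.map_map RealString.measurable_append measurable_prodMk_left]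
    have : RealString.append ∘ Prod.mk ⟨0, Fin.elim0⟩ = id :=
      funext fun w => RealString.append_nil _ w
    rw [this, Measure.map_id]
  | cons b y ih =>
    set g := gaussianReal (bpsk b) (Real.toNNReal (σ ^ 2)) with hg
    have hm := RealString.measurable_append
    have hc := RealString.measurable_cons
    rw [List.cons_append, awgnChannel_cons, awgnChannel_cons, ih, ← hg]
    conv_lhs =>
      rw [← Measure.map_id (μ := g), Measure.map_prod_map _ _ measurable_id hm,
        Measure.map_map hc (measurable_id.prodMap hm)]
    conv_rhs =>
      rw [← Measure.map_id (μ := awgnChannel σ y'), Measure.map_prod_map _ _ hc measurable_id,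
        Measure.map_map hm (hc.prodMap measurable_id)]
    rw [← Measure.prodAssoc_prod, Measure.map_map (hc.comp (measurable_id.prodMap hm))
      MeasurableEquiv.prodAssoc.measurable]
    congr 1
    funext p
    exact (RealString.append_cons p.1.1 p.1.2 p.2).symm

/-! ### Subadditivity of the maximal information -/

lemma syncOutput_append (W : SyncLaw) (x x' : List Bool) :
    syncOutput W (x ++ x') =
      (syncOutput W x).bind fun s => (syncOutput W x').map fun t => s ++ t := by
  induction x with
  | nil =>
    simp only [List.nil_append, syncOutput, PMF.pure_bind]
    exact (PMF.map_id _).symm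
  | cons b x ih =>
    simp only [List.cons_append, syncOutput, ih, PMF.bind_bind, PMF.map_bind, PMF.bind_map,
      PMF.map_comp, Function.comp_def, List.append_assoc]

lemma toMeasure_bind_map_append (p q : PMF (List Bool)) :
    (p.bind fun s => q.map fun t => s ++ t).toMeasure =
      (p.toMeasure.prod q.toMeasure).map fun z => z.1 ++ z.2 := by
  ext s -
  have hs : MeasurableSet s := .of_discrete
  rw [Measure.map_apply .of_discrete hs, Measure.prod_apply .of_discrete,
    PMF.toMeasure_bind_apply _ _ _ hs, lintegral_countable']
  refine tsum_congr fun a => ?_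
  rw [PMF.toMeasure_apply_singleton _ _ (measurableSet_singleton a), mul_comm,
    ← PMF.toMeasure_map _ _ .of_discrete, Measure.map_apply .of_discrete hs]
  rfl

lemma syncChannel_add (W : SyncLaw) (m n : ℕ) (x : Fin (m + n) → Bool) :
    syncChannel W (m + n) x =
      ((syncChannel W m fun i => x (Fin.castAdd n i)).prod
        (syncChannel W n fun i => x (Fin.natAdd m i))).map fun z => z.1 ++ z.2 := by
  change (syncOutput W (List.ofFn x)).toMeasure = _
  rw [List.ofFn_add, syncOutput_append, toMeasure_bind_map_append]
  rfl

lemma prod_bind_bind {α₁ α₂ β₁ β₂ : Type*} [MeasurableSpace α₁] [MeasurableSpace α₂]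
    [MeasurableSpace β₁] [MeasurableSpace β₂] (μ : Measure α₁) (ν : Measure α₂) [SFinite μ]
    [SFinite ν] (κ : Kernel α₁ β₁) (η : Kernel α₂ β₂) [IsSFiniteKernel κ] [IsSFiniteKernel η] :
    (κ ∘ₘ μ).prod (η ∘ₘ ν) = (κ ∥ₖ η) ∘ₘ (μ.prod ν) := by
  rw [Measure.prod_comp_left, Measure.prod_comp_right, Measure.comp_assoc,
    Kernel.parallelComp_id_right_comp_parallelComp]
  simp

lemma awgnSyncChannel_add (W : SyncLaw) (σ : ℝ) (m n : ℕ) (x : Fin (m + n) → Bool) :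
    awgnSyncChannel W σ (m + n) x =
      ((awgnSyncChannel W σ m fun i => x (Fin.castAdd n i)).prod
        (awgnSyncChannel W σ n fun i => x (Fin.natAdd m i))).map RealString.append := by
  simp only [awgnSyncChannel, Kernel.comp_apply]
  rw [syncChannel_add, prod_bind_bind]
  ext s hs
  rw [Measure.bind_apply hs (Kernel.aemeasurable _),
    Measure.map_apply RealString.measurable_append hs,
    Measure.bind_apply (RealString.measurable_append hs) (Kernel.aemeasurable _),
    lintegral_map .of_discrete .of_discrete]
  refine lintegral_congr fun z => ?_
  rw [awgnChannel_append, Measure.map_apply RealString.measurable_append hs,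
    Kernel.parallelComp_apply]

/-! ### Equivocation of the AWGN channel -/

/-- The natural logarithm of the factor in the capacity bound. -/
noncomputable def equivocationBound (σ : ℝ) : ℝ :=
  Real.log (Real.sqrt (Real.exp 1 / 2) * (1 + Real.exp (-(1 / σ ^ 2))))

lemma equivocationBound_pos (σ : ℝ) : 0 < equivocationBound σ := by
  refine Real.log_pos (one_lt_mul_of_le_of_lt ?_ ?_)
  · rw [Real.one_le_sqrt]
    have := Real.add_one_le_exp 1
    linarith
  · linarith [Real.exp_pos (-(1 / σ ^ 2))]

lemma toNNReal_sq_ne_zero {σ : ℝ} (hσ : 0 < σ) : Real.toNNReal (σ ^ 2) ≠ 0 := by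
  simpa using hσ.ne'

lemma coe_toNNReal_sq (σ : ℝ) : ((Real.toNNReal (σ ^ 2) : ℝ≥0) : ℝ) = σ ^ 2 :=
  Real.coe_toNNReal _ (sq_nonneg σ)

/-- The mean of a Gaussian bump under a Gaussian law of the same variance. -/
lemma integral_exp_neg_sq_gaussianReal {σ : ℝ} (hσ : 0 < σ) (a b : ℝ) :
    ∫ t, Real.exp (-(t - a) ^ 2 / (2 * σ ^ 2)) ∂(gaussianReal b (Real.toNNReal (σ ^ 2))) =
      (Real.sqrt 2)⁻¹ * Real.exp (-(a - b) ^ 2 / (4 * σ ^ 2)) := by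
  have hv2 : Real.toNNReal (σ ^ 2 / 2) ≠ 0 := by
    simp only [ne_eq, Real.toNNReal_eq_zero, not_le]
    positivity
  have h2 : ((Real.toNNReal (σ ^ 2 / 2) : ℝ≥0) : ℝ) = σ ^ 2 / 2 :=
    Real.coe_toNNReal _ (by positivity)
  rw [integral_gaussianReal_eq_integral_smul (toNNReal_sq_ne_zero hσ)]
  -- Completing the square: (t - a)² + (t - b)² = 2(t - (a + b)/2)² + (a - b)²/2. The halved
  -- variance yields the factor 1/√2.
  have hpt : ∀ t, gaussianPDFReal b (Real.toNNReal (σ ^ 2)) t •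
      Real.exp (-(t - a) ^ 2 / (2 * σ ^ 2)) =
      ((Real.sqrt 2)⁻¹ * Real.exp (-(a - b) ^ 2 / (4 * σ ^ 2))) *
        gaussianPDFReal ((a + b) / 2) (Real.toNNReal (σ ^ 2 / 2)) t := by
    intro t
    have hs : Real.sqrt (2 * Real.pi * σ ^ 2) =
        Real.sqrt 2 * Real.sqrt (2 * Real.pi * (σ ^ 2 / 2)) := by
      rw [← Real.sqrt_mul (by norm_num)]
      congr 1
      ring
    rw [gaussianPDFReal, gaussianPDFReal, h2, coe_toNNReal_sq, smul_eq_mul, hs, mul_inv,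
      mul_assoc _ (Real.exp _) (Real.exp _), ← Real.exp_add,
      mul_mul_mul_comm _ (Real.exp _) _ (Real.exp _), ← Real.exp_add]
    congr 2
    field_simp
    ring
  simp_rw [hpt]
  rw [integral_const_mul, integral_gaussianPDFReal_eq_one _ hv2, mul_one]

lemma integrable_exp_neg_sq_gaussianReal (σ a b : ℝ) :
    Integrable (fun t => Real.exp (-(t - a) ^ 2 / (2 * σ ^ 2)))
      (gaussianReal b (Real.toNNReal (σ ^ 2))) := by
  refine Integrable.of_bound (by fun_prop) 1 (ae_of_all _ fun t => ?_)
  rw [Real.norm_eq_abs, abs_of_pos (Real.exp_pos _), Real.exp_le_one_iff, neg_div]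
  have : 0 ≤ (t - a) ^ 2 / (2 * σ ^ 2) := by positivity
  linarith

lemma integrable_sub_sq_gaussianReal (b : ℝ) (v : ℝ≥0) :
    Integrable (fun t => (t - b) ^ 2) (gaussianReal b v) :=
  ((memLp_id_gaussianReal (μ := b) (v := v) 2).sub (memLp_const b)).integrable_sq

lemma integral_sub_sq_gaussianReal (b : ℝ) (v : ℝ≥0) :
    ∫ t, (t - b) ^ 2 ∂(gaussianReal b v) = v := by
  have h := variance_id_gaussianReal (μ := b) (v := v)
  rw [variance_eq_integral aemeasurable_id] at h
  simpa using h

/-- The number of nats, `- log P(b | t)`, needed to describe the equiprobable bit `b` when its noisy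
version `t` is known. -/
noncomputable def bitCodeLength (σ : ℝ) (b : Bool) (t : ℝ) : ℝ :=
  Real.log (1 + Real.exp (-(2 * bpsk b * t / σ ^ 2)))

lemma measurable_bitCodeLength (σ : ℝ) (b : Bool) : Measurable (bitCodeLength σ b) := by
  unfold bitCodeLength
  fun_prop

lemma bitCodeLength_nonneg (σ : ℝ) (b : Bool) (t : ℝ) : 0 ≤ bitCodeLength σ b t :=
  Real.log_nonneg (by linarith [Real.exp_pos (-(2 * bpsk b * t / σ ^ 2))])

lemma exp_neg_bitCodeLength (σ : ℝ) (b : Bool) (t : ℝ) :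
    Real.exp (-bitCodeLength σ b t) = (1 + Real.exp (-(2 * bpsk b * t / σ ^ 2)))⁻¹ := by
  rw [Real.exp_neg, bitCodeLength, Real.exp_log (by positivity)]

lemma sum_exp_neg_bitCodeLength (σ t : ℝ) :
    ∑ b, ENNReal.ofReal (Real.exp (-bitCodeLength σ b t)) = 1 := by
  rw [← ENNReal.ofReal_sum_of_nonneg fun _ _ => (Real.exp_pos _).le]
  simp only [Fintype.sum_bool, exp_neg_bitCodeLength, bpsk]
  have h : Real.exp (-(2 * 1 * t / σ ^ 2)) = (Real.exp (-(2 * -1 * t / σ ^ 2)))⁻¹ := by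
    rw [← Real.exp_neg]
    congr 1
    ring
  simp only [if_true, Bool.false_eq_true, if_false, h]
  rw [ENNReal.ofReal_eq_one]
  have := Real.exp_pos (-(2 * -1 * t / σ ^ 2))
  field_simp
  ring

/-- Jensen's inequality for the logarithm, applied to the sum `A` of two Gaussian bumps centred at
±x. Applied directly to 1 + exp(-2xt/σ²), it would give a different bound. -/
lemma lintegral_bitCodeLength_le {σ : ℝ} (hσ : 0 < σ) (b : Bool) :
    ∫⁻ t, ENNReal.ofReal (bitCodeLength σ b t)
        ∂(gaussianReal (bpsk b) (Real.toNNReal (σ ^ 2))) ≤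
      ENNReal.ofReal (equivocationBound σ) := by
  set x := bpsk b with hx
  have hx2 : x ^ 2 = 1 := by
    cases b <;> simp [hx, bpsk]
  set g := gaussianReal x (Real.toNNReal (σ ^ 2)) with hg
  let A : ℝ → ℝ := fun t =>
    Real.exp (-(t - x) ^ 2 / (2 * σ ^ 2)) + Real.exp (-(t - -x) ^ 2 / (2 * σ ^ 2))
  have hA : Integrable A g :=
    (integrable_exp_neg_sq_gaussianReal σ x x).add (integrable_exp_neg_sq_gaussianReal σ (-x) x)
  set K : ℝ := (Real.sqrt 2)⁻¹ * (1 + Real.exp (-(1 / σ ^ 2))) with hK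
  have hKpos : 0 < K := by positivity
  have hAK : ∫ t, A t ∂g = K := by
    rw [integral_add (integrable_exp_neg_sq_gaussianReal σ x x)
      (integrable_exp_neg_sq_gaussianReal σ (-x) x), integral_exp_neg_sq_gaussianReal hσ,
      integral_exp_neg_sq_gaussianReal hσ, hK, mul_add]
    congr 2
    · simp
    · congr 1
      have : -(-x - x) ^ 2 = -(4 * x ^ 2) := by ring
      rw [this, hx2]
      field_simp
  have hQ := integrable_sub_sq_gaussianReal x (Real.toNNReal (σ ^ 2))
  have hAint : Integrable (fun t => A t / K) g := hA.div_const K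
  have hQint : Integrable (fun t => (t - x) ^ 2 / (2 * σ ^ 2)) g := hQ.div_const _
  have hAQ : Integrable (fun t => A t / K + (t - x) ^ 2 / (2 * σ ^ 2)) g := hAint.add hQint
  have hBint : Integrable (fun t => (A t / K + (t - x) ^ 2 / (2 * σ ^ 2)) + (Real.log K - 1)) g :=
    hAQ.add (integrable_const _)
  have hpt : ∀ t, bitCodeLength σ b t ≤
      (A t / K + (t - x) ^ 2 / (2 * σ ^ 2)) + (Real.log K - 1) := by
    intro t
    have hApos : 0 < A t := by positivity
    -- The extracted exponent (t - x)²/(2σ²) has mean 1/2, the source of the factor √e.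
    have h1 : 1 + Real.exp (-(2 * x * t / σ ^ 2)) =
        A t * Real.exp ((t - x) ^ 2 / (2 * σ ^ 2)) := by
      simp only [A]
      rw [add_mul, ← Real.exp_add, ← Real.exp_add]
      congr 1
      · rw [neg_div, neg_add_cancel, Real.exp_zero]
      · congr 1
        field_simp
        ring
    rw [bitCodeLength, ← hx, h1, Real.log_mul hApos.ne' (Real.exp_pos _).ne', Real.log_exp]
    -- Jensen as a tangent line: the logarithm is linearised at `K`, the mean of `A`.
    have h2 := Real.log_le_sub_one_of_pos (div_pos hApos hKpos)
    rw [Real.log_div hApos.ne' hKpos.ne'] at h2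
    linarith
  have hval : ∫ t, ((A t / K + (t - x) ^ 2 / (2 * σ ^ 2)) + (Real.log K - 1)) ∂g =
      equivocationBound σ := by
    rw [integral_add hAQ (integrable_const _), integral_add hAint hQint, integral_div, integral_div, hAK,
      integral_sub_sq_gaussianReal, coe_toNNReal_sq, div_self hKpos.ne']
    simp only [integral_const, probReal_univ, smul_eq_mul, one_mul]
    have hs : Real.sqrt (Real.exp 1 / 2) * (1 + Real.exp (-(1 / σ ^ 2))) =
        Real.sqrt (Real.exp 1) * K := by
      rw [hK, Real.sqrt_div (Real.exp_pos 1).le]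
      ring
    rw [equivocationBound, hs, Real.log_mul (by positivity) hKpos.ne',
      Real.log_sqrt (Real.exp_pos 1).le, Real.log_exp]
    field_simp
    ring
  calc ∫⁻ t, ENNReal.ofReal (bitCodeLength σ b t) ∂g
    _ ≤ ∫⁻ t, ENNReal.ofReal ((A t / K + (t - x) ^ 2 / (2 * σ ^ 2)) + (Real.log K - 1)) ∂g :=
        lintegral_mono fun t => ENNReal.ofReal_le_ofReal (hpt t)
    _ = ENNReal.ofReal (equivocationBound σ) := by
        rw [← ofReal_integral_eq_lintegral_ofReal hBint
          (ae_of_all _ fun t => (bitCodeLength_nonneg σ b t).trans (hpt t)), hval]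

/-- The number of nats needed to describe the bits of `y` when their noisy versions are known. -/
noncomputable def codeLength (σ : ℝ) (y : List Bool) (ω : RealString) : ℝ :=
  -- The default `false` is read only if `ω` is longer than `y`, where `posteriorWeight` vanishes.
  ∑ j : Fin ω.1, bitCodeLength σ (y.getD j false) (ω.2 j)

lemma measurable_codeLength (σ : ℝ) (y : List Bool) : Measurable (codeLength σ y) := by
  refine RealString.measurable_of_mk fun m => ?_
  change Measurable fun t : Fin m → ℝ => ∑ j : Fin m, bitCodeLength σ (y.getD j false) (t j)
  refine Finset.measurable_sum _ fun j _ => ?_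
  exact (measurable_bitCodeLength σ _).comp (measurable_pi_apply j)

lemma codeLength_nonneg (σ : ℝ) (y : List Bool) (ω : RealString) : 0 ≤ codeLength σ y ω :=
  Finset.sum_nonneg fun _ _ => bitCodeLength_nonneg _ _ _

lemma lintegral_codeLength_le {σ : ℝ} (hσ : 0 < σ) (y : List Bool) :
    ∫⁻ ω, ENNReal.ofReal (codeLength σ y ω) ∂(awgnChannel σ y) ≤
      y.length * ENNReal.ofReal (equivocationBound σ) := by
  rw [awgnChannel_apply, lintegral_map (measurable_codeLength σ y).ennreal_ofReal
    (measurable_sigmaMk _)]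
  set μ : Fin y.length → Measure ℝ := fun i =>
    gaussianReal (bpsk (y.get i)) (Real.toNNReal (σ ^ 2)) with hμ
  have hpt : ∀ t : Fin y.length → ℝ, ENNReal.ofReal (codeLength σ y ⟨y.length, t⟩) =
      ∑ j, ENNReal.ofReal (bitCodeLength σ (y.get j) (t j)) := by
    intro t
    rw [codeLength, ENNReal.ofReal_sum_of_nonneg fun _ _ => bitCodeLength_nonneg _ _ _]
    simp
  simp_rw [hpt]
  have hm : ∀ j : Fin y.length, Measurable fun s => ENNReal.ofReal (bitCodeLength σ (y.get j) s) :=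
    fun j => (measurable_bitCodeLength σ _).ennreal_ofReal
  have hm' : ∀ j : Fin y.length, Measurable fun t : Fin y.length → ℝ =>
      ENNReal.ofReal (bitCodeLength σ (y.get j) (t j)) :=
    fun j => (hm j).comp (measurable_pi_apply j)
  rw [lintegral_finsetSum _ fun j _ => hm' j]
  calc ∑ j, ∫⁻ t, ENNReal.ofReal (bitCodeLength σ (y.get j) (t j)) ∂(Measure.pi μ)
    _ = ∑ j, ∫⁻ s, ENNReal.ofReal (bitCodeLength σ (y.get j) s) ∂(μ j) :=
        Finset.sum_congr rfl fun j _ => (measurePreserving_eval μ j).lintegral_comp (hm j)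
    _ ≤ ∑ _j : Fin y.length, ENNReal.ofReal (equivocationBound σ) :=
        Finset.sum_le_sum fun j _ => lintegral_bitCodeLength_le hσ _
    _ = y.length * ENNReal.ofReal (equivocationBound σ) := by simp

/-- The conditional law of a string of equiprobable bits, given the noisy versions of its bits. -/
noncomputable def posteriorWeight (σ : ℝ) (y : List Bool) (ω : RealString) : ℝ≥0∞ :=
  if y.length = ω.1 then ENNReal.ofReal (Real.exp (-codeLength σ y ω)) else 0

lemma measurable_posteriorWeight (σ : ℝ) (y : List Bool) : Measurable (posteriorWeight σ y) := by
  refine Measurable.ite ?_ (measurable_codeLength σ y).neg.exp.ennreal_ofReal measurable_const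
  exact RealString.measurable_length (Set.to_countable {m | y.length = m}).measurableSet

/-- Only strings of the same length as `ω` contribute, and their sum factors into one sum per bit,
each equal to 1. -/
lemma tsum_posteriorWeight (σ : ℝ) (ω : RealString) : ∑' y, posteriorWeight σ y ω = 1 := by
  obtain ⟨m, t⟩ := ω
  rw [← (List.equivSigmaTuple (α := Bool)).symm.tsum_eq, ENNReal.tsum_sigma',
    tsum_eq_single m]
  · rw [tsum_fintype]
    have : ∀ f : Fin m → Bool, posteriorWeight σ (List.equivSigmaTuple.symm ⟨m, f⟩) ⟨m, t⟩ =
        ∏ j, ENNReal.ofReal (Real.exp (-bitCodeLength σ (f j) (t j))) := by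
      intro f
      rw [← ENNReal.ofReal_prod_of_nonneg fun _ _ => (Real.exp_pos _).le, ← Real.exp_sum]
      simp [posteriorWeight, List.equivSigmaTuple, codeLength]
    simp_rw [this]
    rw [← Fintype.prod_sum fun j b => ENNReal.ofReal (Real.exp (-bitCodeLength σ b (t j)))]
    simp only [sum_exp_neg_bitCodeLength, Finset.prod_const_one]
  · intro n hn
    simp [posteriorWeight, List.equivSigmaTuple, hn]

/-- The noise preserves the length, so the zero branch of `posteriorWeight` is almost surely not
taken. -/
lemma exp_neg_codeLength_le_posteriorWeight (σ : ℝ) (y : List Bool) :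
    ∀ᵐ ω ∂(awgnChannel σ y),
      ENNReal.ofReal (Real.exp (-codeLength σ y ω)) ≤ posteriorWeight σ y ω := by
  rw [awgnChannel_apply]
  refine (ae_map_iff (measurable_sigmaMk _).aemeasurable
    (measurableSet_le (measurable_codeLength σ y).neg.exp.ennreal_ofReal
      (measurable_posteriorWeight σ y))).2 (ae_of_all _ fun t => ?_)
  simp [posteriorWeight]

/-! ### Information loss caused by the noise -/

lemma mutualInfo_ne_top {α β : Type*} [MeasurableSpace α] [MeasurableSpace β] [Fintype α]
    [DiscreteMeasurableSpace α] (κ : Kernel α β) [IsMarkovKernel κ] (P : ProbabilityMeasure α) :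
    mutualInfo (P : Measure α) κ ≠ ∞ :=
  ne_top_of_le_ne_top (maxMutualInfo_ne_top κ)
    (le_iSup (fun P : ProbabilityMeasure α => mutualInfo (P : Measure α) κ) P)

lemma mutualInfo_syncChannel_le (W : SyncLaw) {σ : ℝ} (hσ : 0 < σ) {N : ℕ}
    (P : ProbabilityMeasure (Fin N → Bool)) :
    mutualInfo (P : Measure (Fin N → Bool)) (syncChannel W N) ≤
      mutualInfo (P : Measure (Fin N → Bool)) (awgnSyncChannel W σ N) +
        meanLength W P * ENNReal.ofReal (equivocationBound σ / Real.log 2) := by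
  have hlog : 0 < Real.log 2 := Real.log_pos one_lt_two
  have hfin : klDiv ((P : Measure (Fin N → Bool)) ⊗ₘ syncChannel W N)
      ((P : Measure (Fin N → Bool)).prod (syncChannel W N ∘ₘ (P : Measure (Fin N → Bool)))) ≠ ∞ := by
    intro h
    refine mutualInfo_ne_top (syncChannel W N) P ?_
    rw [mutualInfo, h, ENNReal.top_div_of_ne_top ENNReal.ofReal_ne_top]
  have h := klDiv_prod_comp_le_klDiv_add_lintegral (P : Measure (Fin N → Bool)) (syncChannel W N)
    (awgnChannel σ) (posteriorWeight σ) (measurable_posteriorWeight σ)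
    (fun ω => (tsum_posteriorWeight σ ω).le) (codeLength σ) (measurable_codeLength σ)
    (codeLength_nonneg σ) (exp_neg_codeLength_le_posteriorWeight σ) hfin
  have hmean : ∫⁻ y, ∫⁻ ω, ENNReal.ofReal (codeLength σ y ω) ∂(awgnChannel σ y)
      ∂(syncChannel W N ∘ₘ (P : Measure (Fin N → Bool))) ≤
        meanLength W P * ENNReal.ofReal (equivocationBound σ) := by
    refine (lintegral_mono fun y => lintegral_codeLength_le hσ y).trans_eq ?_
    rw [lintegral_mul_const _ .of_discrete]
    rfl
  rw [ENNReal.ofReal_div_of_pos hlog, ← mul_div_assoc]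
  simp only [mutualInfo]
  rw [← ENNReal.add_div]
  exact ENNReal.div_le_div_right (h.trans (add_le_add_right hmean _)) _

/-! ### Existence of the capacities -/

/-- The capacity exists if the maximal information is finite and subadditive. -/
lemma exists_isCapacity {β : Type*} [MeasurableSpace β] (κ : ∀ N : ℕ, Kernel (Fin N → Bool) β)
    (hfin : ∀ N, maxMutualInfo (κ N) ≠ ∞)
    (hsub : ∀ m n, maxMutualInfo (κ (m + n)) ≤ maxMutualInfo (κ m) + maxMutualInfo (κ n)) :
    ∃ C : ℝ≥0, IsCapacity κ C := by
  have hs : Subadditive fun N => (maxMutualInfo (κ N)).toReal := fun m n => by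
    rw [← ENNReal.toReal_add (hfin m) (hfin n)]
    exact ENNReal.toReal_mono (ENNReal.add_ne_top.2 ⟨hfin m, hfin n⟩) (hsub m n)
  -- Fekete's lemma; the sequence is bounded below by 0.
  have hlim := hs.tendsto_lim ⟨0, by
    rintro _ ⟨n, rfl⟩
    positivity⟩
  have h := (ENNReal.continuous_ofReal.tendsto _).comp hlim
  refine ⟨Real.toNNReal hs.lim, h.congr' ?_⟩
  filter_upwards [eventually_gt_atTop 0] with N hN
  rw [Function.comp_apply, ENNReal.ofReal_div_of_pos (by positivity),
    ENNReal.ofReal_toReal (hfin N), ENNReal.ofReal_natCast]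

lemma exists_isCapacity_syncChannel (W : SyncLaw) : ∃ C : ℝ≥0, IsCapacity (syncChannel W) C :=
  exists_isCapacity _ (fun _ => maxMutualInfo_ne_top _) fun m n =>
    maxMutualInfo_le_add _ _ _ (fun x i => x (Fin.castAdd n i)) (fun x i => x (Fin.natAdd m i))
      .of_discrete (syncChannel_add W m n)

lemma exists_isCapacity_awgnSyncChannel (W : SyncLaw) (σ : ℝ) :
    ∃ C : ℝ≥0, IsCapacity (awgnSyncChannel W σ) C :=
  exists_isCapacity _ (fun _ => maxMutualInfo_ne_top _) fun m n =>
    maxMutualInfo_le_add _ _ _ (fun x i => x (Fin.castAdd n i)) (fun x i => x (Fin.natAdd m i))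
      RealString.measurable_append (awgnSyncChannel_add W σ m n)

end SyncAWGN

theorem mainTheorem4 (W : SyncAWGN.SyncLaw) (σ : ℝ) (hσ : 0 < σ) :
    ∃ Cs CAs : ℝ≥0,
      SyncAWGN.IsCapacity (SyncAWGN.syncChannel W) Cs ∧
      SyncAWGN.IsCapacity (SyncAWGN.awgnSyncChannel W σ) CAs ∧
      ∀ (P : ∀ N : ℕ, ProbabilityMeasure (Fin N → Bool)) (r : ℝ≥0),
        SyncAWGN.Achieves (SyncAWGN.syncChannel W) P Cs →
        Tendsto (fun N : ℕ => SyncAWGN.meanLength W (P N) / (N : ℝ≥0∞)) atTop (𝓝 (r : ℝ≥0∞)) →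
        (CAs : ℝ) ≥ (Cs : ℝ) -
          (r : ℝ) * Real.logb 2
            (Real.sqrt (Real.exp 1 / 2) * (1 + Real.exp (-(1 / σ ^ 2)))) := by
  obtain ⟨Cs, hCs⟩ := SyncAWGN.exists_isCapacity_syncChannel W
  obtain ⟨CAs, hCAs⟩ := SyncAWGN.exists_isCapacity_awgnSyncChannel W σ
  refine ⟨Cs, CAs, hCs, hCAs, fun P r hP hr => ?_⟩
  have hlog : 0 < Real.log 2 := Real.log_pos one_lt_two
  set c := SyncAWGN.equivocationBound σ / Real.log 2 with hc
  have hc0 : 0 ≤ c := (div_pos (SyncAWGN.equivocationBound_pos σ) hlog).le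
  -- The bound holds for every block length; `P N` need not be optimal for the noisy channel, whose
  -- information is replaced by its supremum.
  have hlim : (Cs : ℝ≥0∞) ≤ CAs + r * ENNReal.ofReal c := by
    refine le_of_tendsto_of_tendsto' hP
      (hCAs.add (ENNReal.Tendsto.mul_const hr (Or.inr ENNReal.ofReal_ne_top))) fun N => ?_
    rw [← ENNReal.mul_div_right_comm, ← ENNReal.add_div]
    refine ENNReal.div_le_div_right ((SyncAWGN.mutualInfo_syncChannel_le W hσ (P N)).trans ?_) _
    gcongr
    exact le_iSup (fun Q : ProbabilityMeasure (Fin N → Bool) =>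
      SyncAWGN.mutualInfo (Q : Measure (Fin N → Bool)) (SyncAWGN.awgnSyncChannel W σ N)) (P N)
  have hreal : (Cs : ℝ) ≤ CAs + r * c := by
    have := ENNReal.toReal_mono (by finiteness) hlim
    rwa [ENNReal.toReal_add (by finiteness) (by finiteness), ENNReal.toReal_mul,
      ENNReal.toReal_ofReal hc0] at this
  change (Cs : ℝ) - r * c ≤ CAs
  linarith
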